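/- For a non-decreasing function $g:[0,\infty)\to[0,\infty)$ with $g(0)=0$ and a real random variable $X$, let $\|X\|_g := \inf\{\eta>0 : \mathbb{E}[g(|X|/\eta)]\le 1\}\in[0,\infty]$ (with $\inf\emptyset=\infty$). For $\alpha>0$ let $\psi_\alpha(x):=\exp(x^\alpha)-1$, $x\ge 0$. For $\alpha>0$ and $L\ge 0$ let $\Psi_{\alpha,L}:[0,\infty)\to[0,\infty)$ be the inverse of the increasing bijection $$\Psi_{\alpha,L}^{-1}(t) := \sqrt{\log(1+t)} + L\,(\log(1+t))^{1/\alpha},\qquad t\ge 0.$$ Theorem. For every real $\alpha\ge 1$ there is a constant $C_\alpha>0$, depending only on $\alpha$, such that the following holds. Let $X_1,\dots,X_n$ be independent mean-zero real random variables on a probability space with $\|X_i\|_{\psi_\alpha}<\infty$ for all $1\le i\le n$. Then $$\Big\|\sum_{i=1}^n X_i\Big\|_{\Psi_{1,L_n(\alpha)}} \le 2e\sqrt6\,\Big(\sum_{i=1}^n\mathbb{E}[X_i^2]\Big)^{1/2},$$ where $$L_n(\alpha) := \frac{4^{1/\alpha}C_\alpha}{2\sqrt6}\,(\log(n+1))^{1/\alpha}\Big(\sum_{i=1}^n\mathbb{E}[X_i^2]\Big)^{-1/2}\max_{1\le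 i\le n}\|X_i\|_{\psi_\alpha}.$$ (If $\sum_{i=1}^n\mathbb{E}[X_i^2]=0$, then all $X_i$ vanish almost surely and $L_n(\alpha)$ is read as $0$.) -/

import Mathlib

open MeasureTheory ProbabilityTheory Set
open scoped ENNReal

namespace GBO

noncomputable section

/-- The `g`-Orlicz norm `inf {η > 0 : E[g(|X|/η)] ≤ 1}` of a real random variable `X`.
It takes values in `[0, ∞]`, the infimum of the empty set being `∞`. Only the values of `g`
on `[0, ∞)`, which are meant to be nonnegative, enter. -/
def orliczNorm {Ω : Type*} [MeasurableSpace Ω] (μ : Measure Ω) (g : ℝ → ℝ) (X : Ω → ℝ) : ℝ≥0∞ :=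
  ⨅ (η : ℝ) (_ : 0 < η) (_ : ∫⁻ ω, ENNReal.ofReal (g (|X ω| / η)) ∂μ ≤ 1), ENNReal.ofReal η

/-- The function `ψ_α(x) = exp(x^α) - 1`, for `x ≥ 0`. -/
def psi (α : ℝ) (x : ℝ) : ℝ := Real.exp (x ^ α) - 1

/-- The function `Ψ_{α,L}⁻¹(t) = √(log(1+t)) + L (log(1+t))^{1/α}`, for `t ≥ 0`. -/
def PsiInv (α L : ℝ) (t : ℝ) : ℝ :=
  √(Real.log (1 + t)) + L * (Real.log (1 + t)) ^ (1 / α)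

/-- The function `Ψ_{α,L}`: the inverse of the bijection `PsiInv α L` of `[0, ∞)` onto itself
(see `PsiInv_bijOn`). -/
def Psi (α L : ℝ) : ℝ → ℝ := Function.invFunOn (PsiInv α L) (Ici 0)

theorem PsiInv_bijOn {α L : ℝ} (hα : 0 < α) (hL : 0 ≤ L) :
    BijOn (PsiInv α L) (Ici 0) (Ici 0) := by
  have hlog : ∀ t ∈ Ici (0 : ℝ), 0 ≤ Real.log (1 + t) := fun t ht =>
    Real.log_nonneg (by linarith [mem_Ici.1 ht])
  have hα' : 0 < 1 / α := by positivity
  have hmono : StrictMonoOn (PsiInv α L) (Ici 0) := by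
    intro s hs t ht hst
    have h1 : Real.log (1 + s) < Real.log (1 + t) :=
      Real.log_lt_log (by linarith [mem_Ici.1 hs]) (by linarith)
    have h2 := Real.sqrt_lt_sqrt (hlog s hs) h1
    have h3 := Real.rpow_le_rpow (hlog s hs) h1.le hα'.le
    have h4 := mul_le_mul_of_nonneg_left h3 hL
    unfold PsiInv
    linarith
  refine ⟨?_, hmono.injOn, ?_⟩
  · intro t ht
    have := hlog t ht
    simp only [mem_Ici, PsiInv]
    positivity
  · intro y hy
    have hy0 : 0 ≤ y := hy
    have hcont : ContinuousOn (PsiInv α L) (Icc 0 (Real.exp (y ^ 2) - 1)) := by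
      have hl : ContinuousOn (fun t : ℝ => Real.log (1 + t)) (Icc 0 (Real.exp (y ^ 2) - 1)) :=
        ContinuousOn.log (by fun_prop) (fun t ht => by linarith [ht.1])
      exact hl.sqrt.add (continuousOn_const.mul (hl.rpow_const fun _ _ => Or.inr hα'.le))
    have hle : (0 : ℝ) ≤ Real.exp (y ^ 2) - 1 := by
      have := Real.one_le_exp (sq_nonneg y)
      linarith
    have h0 : PsiInv α L 0 ≤ y := by
      simpa [PsiInv, Real.zero_rpow (inv_ne_zero hα.ne')] using hy0
    have h1 : y ≤ PsiInv α L (Real.exp (y ^ 2) - 1) := by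
      have h2 : 0 ≤ L * (y ^ 2) ^ (1 / α) := by positivity
      have h3 : PsiInv α L (Real.exp (y ^ 2) - 1) = y + L * (y ^ 2) ^ (1 / α) := by
        simp [PsiInv, Real.sqrt_sq hy0]
      linarith
    obtain ⟨t, ht, hty⟩ := intermediate_value_Icc hle hcont ⟨h0, h1⟩
    exact ⟨t, ht.1, hty⟩

theorem invOn_Psi {α L : ℝ} (hα : 0 < α) (hL : 0 ≤ L) :
    InvOn (Psi α L) (PsiInv α L) (Ici 0) (Ici 0) :=
  (PsiInv_bijOn hα hL).invOn_invFunOn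

end

end GBO

namespace GBO

open Real

/-! ### Moments controlled by the `ψ_α`-norm. -/

section Orlicz

variable {Ω : Type*} [MeasurableSpace Ω] {μ : Measure Ω} {X : Ω → ℝ} {α r : ℝ}

/-! Let `M` be the largest `ψ_α`-norm and `V` the sum of the second moments. For `|x| ≤ 1`, `exp x ≤
1 + x + x ^ 2`. For larger `|x|`, `exp_le_quadratic_add` pays with `exp (1 - b)` times an
exponential of `(|X| / r) ^ α`, whose mean is at most `2`. Since `α ≥ 1`, this works for all `|l| ≤
1 / (b ^ (1 / α) * r)`.

With `b = 6 log (n + 1)` the `n` errors add up to at most `2 / 5`; this choice is the source of the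
factor `(log (n + 1)) ^ (1 / α)`. By independence the sum has mgf at most `exp (l ^ 2 * V + 2 / 5)`
on this range. Chernoff's bound then gives a Bernstein tail at `√t + L * t` with decay `exp (-4 *
t)`, and integrating it against `exp t` bounds the Orlicz norm (`orliczNorm_Psi_le_of_tail`). -/

theorem orliczNorm_le {g : ℝ → ℝ} {η : ℝ} (hη : 0 < η)
    (h : ∫⁻ ω, ENNReal.ofReal (g (|X ω| / η)) ∂μ ≤ 1) :
    orliczNorm μ g X ≤ ENNReal.ofReal η :=
  iInf_le_of_le η (iInf_le_of_le hη (iInf_le _ h))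

theorem exists_lintegral_le_of_orliczNorm_lt {g : ℝ → ℝ}
    (h : orliczNorm μ g X < ENNReal.ofReal r) :
    ∃ η, 0 < η ∧ η < r ∧ ∫⁻ ω, ENNReal.ofReal (g (|X ω| / η)) ∂μ ≤ 1 := by
  simp only [orliczNorm, iInf_lt_iff] at h
  obtain ⟨η, hη, hint, hlt⟩ := h
  exact ⟨η, hη, (ENNReal.ofReal_lt_ofReal_iff_of_nonneg hη.le).1 hlt, hint⟩

/-- A bound on the `ψ_α`-norm controls the exponential moment of `(|X| / r) ^ α`. -/
theorem integrable_exp_rpow_of_orliczNorm_lt [IsProbabilityMeasure μ] (hα : 0 ≤ α)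
    (hX : Measurable X) (h : orliczNorm μ (psi α) X < ENNReal.ofReal r) :
    Integrable (fun ω => exp ((|X ω| / r) ^ α)) μ ∧ ∫ ω, exp ((|X ω| / r) ^ α) ∂μ ≤ 2 := by
  obtain ⟨η, hη, hηr, hint⟩ := exists_lintegral_le_of_orliczNorm_lt h
  have hr : 0 < r := hη.trans hηr
  have key : ∫⁻ ω, ENNReal.ofReal (exp ((|X ω| / r) ^ α)) ∂μ ≤ 2 := by
    calc ∫⁻ ω, ENNReal.ofReal (exp ((|X ω| / r) ^ α)) ∂μ
        ≤ ∫⁻ ω, (ENNReal.ofReal (psi α (|X ω| / η)) + 1) ∂μ := by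
          refine lintegral_mono fun ω => ?_
          rw [← ENNReal.ofReal_one, ← ENNReal.ofReal_add _ zero_le_one]
          · refine ENNReal.ofReal_le_ofReal ?_
            rw [psi, sub_add_cancel]
            gcongr
          · exact sub_nonneg.2 (one_le_exp (by positivity))
      _ = ∫⁻ ω, ENNReal.ofReal (psi α (|X ω| / η)) ∂μ + 1 := by
          rw [lintegral_add_right _ measurable_const]; simp
      _ ≤ 2 := (add_le_add_left hint 1).trans_eq one_add_one_eq_two
  have hmeas : AEStronglyMeasurable (fun ω => exp ((|X ω| / r) ^ α)) μ :=
    (by fun_prop : Measurable fun ω => exp ((|X ω| / r) ^ α)).aestronglyMeasurable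
  have hnn : 0 ≤ᵐ[μ] fun ω => exp ((|X ω| / r) ^ α) := .of_forall fun ω => (exp_pos _).le
  refine ⟨⟨hmeas, ?_⟩, ?_⟩
  · rw [hasFiniteIntegral_iff_ofReal hnn]
    exact key.trans_lt (by norm_num)
  · rw [integral_eq_lintegral_of_nonneg_ae hnn hmeas]
    exact ENNReal.toReal_le_of_le_ofReal (by norm_num) (by simpa using key)

theorem sq_le_two_mul_exp_rpow (hα : 1 ≤ α) {u : ℝ} (hu : 0 ≤ u) :
    u ^ 2 ≤ 2 * exp (u ^ α) := by
  rcases le_total u 1 with h | h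
  · have := one_le_exp (rpow_nonneg hu α)
    nlinarith
  · have h1 : exp u ≤ exp (u ^ α) := exp_le_exp.2 (self_le_rpow_of_one_le h hα)
    have h2 := quadratic_le_exp_of_nonneg hu
    linarith

theorem integrable_sq_of_orliczNorm_lt [IsProbabilityMeasure μ] (hα : 1 ≤ α)
    (hX : Measurable X) (hr : 0 < r) (h : orliczNorm μ (psi α) X < ENNReal.ofReal r) :
    Integrable (fun ω => X ω ^ 2) μ ∧ ∫ ω, X ω ^ 2 ∂μ ≤ 4 * r ^ 2 := by
  obtain ⟨hint, hle⟩ := integrable_exp_rpow_of_orliczNorm_lt (zero_le_one.trans hα) hX h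
  have hb : ∀ ω, X ω ^ 2 ≤ 2 * r ^ 2 * exp ((|X ω| / r) ^ α) := fun ω => by
    have h1 := sq_le_two_mul_exp_rpow hα (u := |X ω| / r) (by positivity)
    rw [div_pow, sq_abs, div_le_iff₀ (by positivity)] at h1
    linarith
  have hi : Integrable (fun ω => X ω ^ 2) μ :=
    (hint.const_mul (2 * r ^ 2)).mono' (by fun_prop)
      (.of_forall fun ω => by simpa using hb ω)
  refine ⟨hi, (integral_mono hi (hint.const_mul _) hb).trans ?_⟩
  rw [integral_const_mul]
  nlinarith [sq_nonneg r]

end Orlicz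

/-! ### Moment generating functions near the origin. -/

section Mgf

/-- A quadratic bound on `exp x`, with an error term that is only needed for large `|x|`. -/
theorem exp_le_quadratic_add {α b κ u x : ℝ} (hα : 1 ≤ α) (hb : 1 ≤ b) (hκ : 0 < κ)
    (hκb : κ ^ α = b) (hx : |x| ≤ u / κ) :
    exp x ≤ 1 + x + x ^ 2 + exp (1 - b) * exp (u ^ α) := by
  rcases le_or_gt |x| 1 with h | h
  · have h1 := (abs_le.1 (abs_exp_sub_one_sub_id_le h)).2
    have : 0 < exp (1 - b) * exp (u ^ α) := by positivity
    linarith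
  · have hv : 1 ≤ u / κ := h.le.trans hx
    have hu : u ^ α = b * (u / κ) ^ α := by
      rw [← hκb, ← mul_rpow hκ.le (by linarith), mul_div_cancel₀ _ hκ.ne']
    have h1 : u / κ ≤ (u / κ) ^ α := self_le_rpow_of_one_le hv hα
    -- With `v = u / κ ≥ 1`, `1 - b + u ^ α = 1 + b * (v ^ α - 1) ≥ v ≥ x`, as `b ≥ 1` and `v ^ α ≥
    -- v`.
    have h2 : x ≤ 1 - b + u ^ α := by
      rw [hu]
      nlinarith [le_abs_self x]
    rw [← exp_add]
    nlinarith [exp_le_exp.2 h2, sq_nonneg (x + 1 / 2)]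

variable {Ω : Type*} [MeasurableSpace Ω] {μ : Measure Ω} [IsProbabilityMeasure μ] {α r b κ : ℝ}

/-- A centred variable with finite `ψ_α`-norm has a subgaussian moment generating function
near `0`, up to a small factor. -/
theorem mgf_le_of_orliczNorm_lt {X : Ω → ℝ} (hα : 1 ≤ α) (hX : Measurable X) (hr : 0 < r)
    (h : orliczNorm μ (psi α) X < ENNReal.ofReal r) (hmean : ∫ ω, X ω ∂μ = 0)
    (hb : 1 ≤ b) (hκ : 0 < κ) (hκb : κ ^ α = b) {l : ℝ} (hl : |l| ≤ 1 / (κ * r)) :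
    Integrable (fun ω => exp (l * X ω)) μ ∧
      mgf X μ l ≤ exp (l ^ 2 * ∫ ω, X ω ^ 2 ∂μ + 2 * exp (1 - b)) := by
  obtain ⟨hint, hle⟩ := integrable_exp_rpow_of_orliczNorm_lt (zero_le_one.trans hα) hX h
  obtain ⟨hsq, -⟩ := integrable_sq_of_orliczNorm_lt hα hX hr h
  have hX1 : Integrable X μ :=
    ((memLp_two_iff_integrable_sq hX.aestronglyMeasurable).2 hsq).integrable one_le_two
  have hpt : ∀ ω, exp (l * X ω) ≤
      1 + l * X ω + l ^ 2 * X ω ^ 2 + exp (1 - b) * exp ((|X ω| / r) ^ α) := fun ω => by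
    rw [← mul_pow]
    refine exp_le_quadratic_add hα hb hκ hκb ?_
    rw [abs_mul]
    calc |l| * |X ω| ≤ 1 / (κ * r) * |X ω| := by gcongr
      _ = |X ω| / r / κ := by field_simp
  have i1 : Integrable (fun ω => 1 + l * X ω) μ := (integrable_const _).add (hX1.const_mul l)
  have i2 : Integrable (fun ω => 1 + l * X ω + l ^ 2 * X ω ^ 2) μ :=
    i1.add (hsq.const_mul (l ^ 2))
  have i3 : Integrable (fun ω => 1 + l * X ω + l ^ 2 * X ω ^ 2
      + exp (1 - b) * exp ((|X ω| / r) ^ α)) μ := i2.add (hint.const_mul (exp (1 - b)))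
  have hi : Integrable (fun ω => exp (l * X ω)) μ :=
    i3.mono' (by fun_prop) (.of_forall fun ω => by simpa using hpt ω)
  refine ⟨hi, ?_⟩
  calc mgf X μ l ≤ ∫ ω, (1 + l * X ω + l ^ 2 * X ω ^ 2
          + exp (1 - b) * exp ((|X ω| / r) ^ α)) ∂μ := integral_mono hi i3 hpt
    _ = 1 + l ^ 2 * ∫ ω, X ω ^ 2 ∂μ + exp (1 - b) * ∫ ω, exp ((|X ω| / r) ^ α) ∂μ := by
        rw [integral_add i2 (hint.const_mul _), integral_add i1 (hsq.const_mul _),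
          integral_add (integrable_const _) (hX1.const_mul l)]
        simp [integral_const_mul, hmean]
    _ ≤ (l ^ 2 * ∫ ω, X ω ^ 2 ∂μ + 2 * exp (1 - b)) + 1 := by
        nlinarith [exp_pos (1 - b)]
    _ ≤ _ := add_one_le_exp _

theorem mgf_sum_le_of_orliczNorm_lt {n : ℕ} {X : Fin n → Ω → ℝ} (hα : 1 ≤ α)
    (hX : ∀ i, Measurable (X i)) (hind : iIndepFun X μ) (hr : 0 < r)
    (h : ∀ i, orliczNorm μ (psi α) (X i) < ENNReal.ofReal r) (hmean : ∀ i, ∫ ω, X i ω ∂μ = 0)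
    (hb : 1 ≤ b) (hκ : 0 < κ) (hκb : κ ^ α = b) {l : ℝ} (hl : |l| ≤ 1 / (κ * r)) :
    Integrable (fun ω => exp (l * ∑ i, X i ω)) μ ∧
      mgf (fun ω => ∑ i, X i ω) μ l ≤
        exp (l ^ 2 * ∑ i, ∫ ω, X i ω ^ 2 ∂μ + n * (2 * exp (1 - b))) := by
  have key := fun i => mgf_le_of_orliczNorm_lt hα (hX i) hr (h i) (hmean i) hb hκ hκb hl
  have hS : (fun ω => ∑ i, X i ω) = ∑ i, X i := by ext ω; simp
  constructor
  · have := hind.integrable_exp_mul_sum (t := l) hX (s := Finset.univ) fun i _ => (key i).1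
    simpa using this
  · rw [hS, hind.mgf_sum hX]
    calc ∏ i, mgf (X i) μ l
        ≤ ∏ i, exp (l ^ 2 * ∫ ω, X i ω ^ 2 ∂μ + 2 * exp (1 - b)) :=
          Finset.prod_le_prod (fun i _ => mgf_nonneg) fun i _ => (key i).2
      _ = _ := by
          rw [← exp_sum, Finset.sum_add_distrib, ← Finset.mul_sum]
          simp

theorem nat_mul_exp_one_sub_le {n : ℕ} (hn : 1 ≤ n) :
    n * (2 * exp (1 - 6 * log (n + 1))) ≤ 2 / 5 := by
  have hn' : (1 : ℝ) ≤ n := by exact_mod_cast hn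
  have h6 : exp (6 * log (n + 1)) = ((n : ℝ) + 1) ^ 6 := by
    rw [mul_comm, exp_mul, exp_log (by positivity)]
    exact_mod_cast rfl
  rw [exp_sub, h6]
  have he := exp_one_lt_d9
  have h5 : (2 : ℝ) ^ 5 ≤ (n + 1) ^ 5 := by gcongr; linarith
  have h7 : (n : ℝ) * 32 ≤ (n + 1) ^ 6 := by
    calc (n : ℝ) * 32 ≤ (n + 1) * (n + 1) ^ 5 := by gcongr <;> linarith
      _ = _ := by ring
  rw [← mul_div_assoc, ← mul_div_assoc, div_le_iff₀ (by positivity)]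
  nlinarith

end Mgf

/-! ### Bernstein tails by Chernoff's method. -/

section Tail

variable {Ω : Type*} [MeasurableSpace Ω] {μ : Measure Ω} [IsProbabilityMeasure μ]
  {S : Ω → ℝ} {σ K d c₁ c₂ : ℝ}

/-- One-sided Bernstein inequality from a bound on the moment generating function. -/
theorem measureReal_ge_le_of_mgf_le (hσ : 0 < σ) (hK : 0 < K) (hc₁ : 5 ≤ c₁) (hc₂ : 4 ≤ c₂)
    (hint : ∀ l, |l| ≤ 1 / K → Integrable (fun ω => exp (l * S ω)) μ)
    (hmgf : ∀ l, |l| ≤ 1 / K → mgf S μ l ≤ exp (l ^ 2 * σ ^ 2 + d)) {t : ℝ} (ht : 0 ≤ t) :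
    μ.real {ω | c₁ * σ * √t + c₂ * K * t ≤ S ω} ≤ exp (d - 4 * t) := by
  set s := c₁ * σ * √t + c₂ * K * t with hs
  have hst : √t ^ 2 = t := sq_sqrt ht
  have hs0 := sqrt_nonneg t
  have main : ∀ l, 0 ≤ l → l ≤ 1 / K → l ^ 2 * σ ^ 2 - l * s ≤ -4 * t →
      μ.real {ω | s ≤ S ω} ≤ exp (d - 4 * t) := by
    intro l hl0 hl hle
    have hl' : |l| ≤ 1 / K := by rwa [abs_of_nonneg hl0]
    calc μ.real {ω | s ≤ S ω} ≤ exp (-l * s) * mgf S μ l :=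
          measure_ge_le_exp_mul_mgf s hl0 (hint l hl')
      _ ≤ exp (-l * s) * exp (l ^ 2 * σ ^ 2 + d) := by gcongr; exact hmgf l hl'
      _ ≤ exp (d - 4 * t) := by
          rw [← exp_add]
          exact exp_le_exp.2 (by linarith)
  -- Take `l = min (√t / σ) (1 / K)`. In the first case `l ^ 2 * σ ^ 2 = t`, so `c₁ ≥ 5` leaves `-4
  -- * t`. In the second the `c₁` term absorbs `l ^ 2 * σ ^ 2`, and `c₂ ≥ 4` supplies `-4 * t`.
  rcases le_total (√t / σ) (1 / K) with h | h
  · refine main (√t / σ) (by positivity) h ?_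
    have h1 : (√t / σ) ^ 2 * σ ^ 2 = t := by rw [← mul_pow, div_mul_cancel₀ _ hσ.ne', hst]
    have h2 : √t / σ * (c₁ * σ * √t) = c₁ * t := by
      field_simp
      rw [hst]
    have h3 : 0 ≤ √t / σ * (c₂ * K * t) := by positivity
    rw [hs, mul_add, h1, h2]
    nlinarith
  · refine main (1 / K) (by positivity) le_rfl ?_
    have h1 : 1 / K * (c₂ * K * t) = c₂ * t := by field_simp
    have h2 : 1 / K * σ ≤ √t := by rwa [← le_div_iff₀ hσ]
    have h3 : 0 < 1 / K * σ := by positivity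
    have h4 : (1 / K) ^ 2 * σ ^ 2 - 1 / K * (c₁ * σ * √t)
        = (1 / K * σ) * (1 / K * σ - c₁ * √t) := by ring
    have h5 : 1 / K * σ - c₁ * √t ≤ 0 := by nlinarith
    rw [hs, mul_add, h1]
    nlinarith [mul_nonneg h3.le (neg_nonneg.2 h5)]

theorem measureReal_abs_ge_le_of_mgf_le (hσ : 0 < σ) (hK : 0 < K) (hc₁ : 5 ≤ c₁) (hc₂ : 4 ≤ c₂)
    (hint : ∀ l, |l| ≤ 1 / K → Integrable (fun ω => exp (l * S ω)) μ)
    (hmgf : ∀ l, |l| ≤ 1 / K → mgf S μ l ≤ exp (l ^ 2 * σ ^ 2 + d)) {t : ℝ} (ht : 0 ≤ t) :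
    μ.real {ω | c₁ * σ * √t + c₂ * K * t ≤ |S ω|} ≤ 2 * exp (d - 4 * t) := by
  have h1 := measureReal_ge_le_of_mgf_le hσ hK hc₁ hc₂ hint hmgf ht
  have h2 := measureReal_ge_le_of_mgf_le (S := -S) hσ hK hc₁ hc₂
    (fun l hl => by simpa using hint (-l) (by simpa using hl))
    (fun l hl => by simpa [mgf_neg] using hmgf (-l) (by simpa using hl)) ht
  have hsub : {ω | c₁ * σ * √t + c₂ * K * t ≤ |S ω|} ⊆
      {ω | c₁ * σ * √t + c₂ * K * t ≤ S ω} ∪ {ω | c₁ * σ * √t + c₂ * K * t ≤ (-S) ω} :=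
    fun ω hω => by simpa [le_abs] using hω
  have h3 := (measureReal_mono hsub).trans (measureReal_union_le (μ := μ) _ _)
  linarith

end Tail

/-! ### The function `Ψ_{1,L}` and its Orlicz norm. -/

section Psi

variable {L : ℝ}

theorem Psi_nonneg (hL : 0 ≤ L) {x : ℝ} (hx : 0 ≤ x) : 0 ≤ Psi 1 L x :=
  (PsiInv_bijOn one_pos hL).surjOn.mapsTo_invFunOn hx

theorem PsiInv_Psi (hL : 0 ≤ L) {x : ℝ} (hx : 0 ≤ x) : PsiInv 1 L (Psi 1 L x) = x :=
  (invOn_Psi one_pos hL).2 hx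

theorem PsiInv_one (t : ℝ) : PsiInv 1 L t = √(log (1 + t)) + L * log (1 + t) := by
  simp [PsiInv]

theorem PsiInv_strictMonoOn (hL : 0 ≤ L) : StrictMonoOn (PsiInv 1 L) (Ici 0) := by
  intro s hs t _ hst
  have hs' : 0 ≤ s := hs
  have h1 : log (1 + s) < log (1 + t) := log_lt_log (by linarith) (by linarith)
  have h2 := sqrt_lt_sqrt (log_nonneg (by linarith)) h1
  rw [PsiInv_one, PsiInv_one]
  nlinarith

theorem Psi_monotoneOn (hL : 0 ≤ L) : MonotoneOn (Psi 1 L) (Ici 0) := by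
  intro x hx y hy hxy
  rw [← (PsiInv_strictMonoOn hL).le_iff_le (Psi_nonneg hL hx) (Psi_nonneg hL hy),
    PsiInv_Psi hL hx, PsiInv_Psi hL hy]
  exact hxy

theorem Psi_zero (hL : 0 ≤ L) : Psi 1 L 0 = 0 := by
  have h := (invOn_Psi one_pos hL).1 (mem_Ici.2 le_rfl)
  simpa [PsiInv] using h

theorem measurable_Psi_abs_div {Ω : Type*} [MeasurableSpace Ω] {S : Ω → ℝ} (hS : Measurable S)
    (hL : 0 ≤ L) {η : ℝ} (hη : 0 ≤ η) : Measurable fun ω => Psi 1 L (|S ω| / η) := by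
  -- `Psi` is controlled only on `[0, ∞)`; truncating the argument makes it monotone on all of `ℝ`.
  have hmono : Monotone fun x : ℝ => Psi 1 L (max x 0) := fun x y hxy =>
    Psi_monotoneOn hL (mem_Ici.2 (le_max_right x 0)) (mem_Ici.2 (le_max_right y 0))
      (max_le_max_right 0 hxy)
  have heq : (fun ω => Psi 1 L (|S ω| / η)) =
      (fun x : ℝ => Psi 1 L (max x 0)) ∘ fun ω => |S ω| / η := by
    ext ω
    simp [max_eq_left (show 0 ≤ |S ω| / η by positivity)]
  rw [heq]
  exact hmono.measurable.comp (by fun_prop)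

/-- Bernstein-type tails give a bound on the Orlicz norm for `Ψ_{1,L}`. -/
theorem orliczNorm_Psi_le_of_tail {Ω : Type*} [MeasurableSpace Ω] {μ : Measure Ω}
    [IsProbabilityMeasure μ] {S : Ω → ℝ} (hS : Measurable S) (hL : 0 ≤ L) {η : ℝ} (hη : 0 < η)
    (htail : ∀ t, 0 ≤ t → μ.real {ω | η * (√t + L * t) ≤ |S ω|} ≤ 3 * exp (-4 * t)) :
    orliczNorm μ (Psi 1 L) S ≤ ENNReal.ofReal η := by
  refine orliczNorm_le hη ?_
  -- In terms of `Y`, `|S| = η * (√Y + L * Y)` and the integrand is `exp Y - 1`, so the layer-cake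
  -- formula reduces the claim to `∫ 3 exp (-3 t) = 1`.
  set Y : Ω → ℝ := fun ω => log (1 + Psi 1 L (|S ω| / η)) with hY
  have hx : ∀ ω, 0 ≤ |S ω| / η := fun ω => by positivity
  have hP : ∀ ω, 0 ≤ Psi 1 L (|S ω| / η) := fun ω => Psi_nonneg hL (hx ω)
  have hY0 : ∀ ω, 0 ≤ Y ω := fun ω => log_nonneg (by linarith [hP ω])
  have hYm : Measurable Y :=
    measurable_log.comp (measurable_const.add (measurable_Psi_abs_div hS hL hη.le))
  have hYS : ∀ ω, η * (√(Y ω) + L * Y ω) = |S ω| := fun ω => by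
    rw [hY, ← PsiInv_one, PsiInv_Psi hL (hx ω), mul_div_cancel₀ _ hη.ne']
  have hPsi : ∀ ω, Psi 1 L (|S ω| / η) = ∫ t in (0 : ℝ)..Y ω, exp t := fun ω => by
    rw [integral_exp, exp_zero, hY, exp_log (by linarith [hP ω])]
    ring
  simp_rw [hPsi]
  rw [lintegral_comp_eq_lintegral_meas_le_mul μ (.of_forall hY0) hYm.aemeasurable
    (fun t _ => continuous_exp.intervalIntegrable _ _) (.of_forall fun t => (exp_pos t).le)]
  have hexp : IntegrableOn (fun t : ℝ => 3 * exp (-3 * t)) (Ioi 0) :=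
    (integrableOn_exp_mul_Ioi (by norm_num) 0).const_mul 3
  calc ∫⁻ t in Ioi 0, μ {ω | t ≤ Y ω} * ENNReal.ofReal (exp t)
      ≤ ∫⁻ t in Ioi 0, ENNReal.ofReal (3 * exp (-3 * t)) := by
        refine setLIntegral_mono' measurableSet_Ioi fun t ht => ?_
        have ht' : 0 ≤ t := le_of_lt ht
        have hsub : {ω | t ≤ Y ω} ⊆ {ω | η * (√t + L * t) ≤ |S ω|} := fun ω hω => by
          have hω' : t ≤ Y ω := hω
          rw [mem_ofPred_eq, ← hYS ω]
          gcongr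
        have h1 : μ {ω | t ≤ Y ω} ≤ ENNReal.ofReal (3 * exp (-4 * t)) := by
          rw [← ofReal_measureReal]
          exact ENNReal.ofReal_le_ofReal ((measureReal_mono hsub).trans (htail t ht'))
        calc μ {ω | t ≤ Y ω} * ENNReal.ofReal (exp t)
            ≤ ENNReal.ofReal (3 * exp (-4 * t)) * ENNReal.ofReal (exp t) := by gcongr
          _ = ENNReal.ofReal (3 * exp (-3 * t)) := by
              rw [← ENNReal.ofReal_mul (by positivity), mul_assoc, ← exp_add]
              ring_nf
    _ = ENNReal.ofReal (∫ t in Ioi (0 : ℝ), 3 * exp (-3 * t)) :=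
        (ofReal_integral_eq_lintegral_ofReal hexp (.of_forall fun t => by positivity)).symm
    _ = 1 := by
        rw [integral_const_mul, integral_exp_mul_Ioi (by norm_num)]
        norm_num

theorem orliczNorm_Psi_eq_zero_of_ae_eq_zero {Ω : Type*} [MeasurableSpace Ω] {μ : Measure Ω}
    {S : Ω → ℝ} (hL : 0 ≤ L) (hS : S =ᵐ[μ] 0) : orliczNorm μ (Psi 1 L) S = 0 := by
  refine le_antisymm (ENNReal.le_of_forall_pos_le_add fun ε hε _ => ?_) zero_le
  have h : ∫⁻ ω, ENNReal.ofReal (Psi 1 L (|S ω| / ε)) ∂μ = 0 := by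
    rw [← lintegral_zero (μ := μ)]
    refine lintegral_congr_ae ?_
    filter_upwards [hS] with ω hω
    simp [hω, Psi_zero hL]
  simpa using orliczNorm_le (NNReal.coe_pos.2 hε) (h.le.trans zero_le_one)

end Psi

end GBO

/-! ### The theorem, with its constants. -/

open GBO Real in
theorem mainTheorem3 (α : ℝ) (hα : 1 ≤ α) :
    ∃ C : ℝ, 0 < C ∧
      ∀ (Ω : Type*) [MeasurableSpace Ω] (μ : Measure Ω) [IsProbabilityMeasure μ]
        (n : ℕ) (X : Fin n → Ω → ℝ),
        (∀ i, Measurable (X i)) →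
        iIndepFun X μ →
        (∀ i, ∫ ω, X i ω ∂μ = 0) →
        (∀ i, GBO.orliczNorm μ (GBO.psi α) (X i) < ∞) →
        ∀ L : ℝ,
          L = 4 ^ (1 / α) * C / (2 * √6) * (Real.log (n + 1)) ^ (1 / α)
              * (√(∑ i, ∫ ω, (X i ω) ^ 2 ∂μ))⁻¹
              * (⨆ i, GBO.orliczNorm μ (GBO.psi α) (X i)).toReal →
          GBO.orliczNorm μ (GBO.Psi 1 L) (fun ω => ∑ i, X i ω) ≤
            ENNReal.ofReal (2 * Real.exp 1 * √6 * √(∑ i, ∫ ω, (X i ω) ^ 2 ∂μ)) := by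
  have hα0 : 0 < α := one_pos.trans_le hα
  refine ⟨8 * 6 ^ (1 / α), by positivity, ?_⟩
  intro Ω _ μ _ n X hX hind hmean hfin L hL
  have hLnn : 0 ≤ L := by
    have : 0 ≤ log ((n : ℝ) + 1) := log_nonneg (by linarith [n.cast_nonneg (α := ℝ)])
    rw [hL]
    positivity
  set M := (⨆ i, orliczNorm μ (psi α) (X i)).toReal with hM
  have hle : ∀ i, orliczNorm μ (psi α) (X i) ≤ ENNReal.ofReal M := fun i => by
    have htop : (⨆ i, orliczNorm μ (psi α) (X i)) < ∞ := by
      rcases isEmpty_or_nonempty (Fin n) with _ | _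
      · simp
      · obtain ⟨j, hj⟩ := exists_eq_ciSup_of_finite (f := fun i => orliczNorm μ (psi α) (X i))
        exact hj ▸ hfin j
    rw [hM, ENNReal.ofReal_toReal htop.ne]
    exact le_iSup (fun i => orliczNorm μ (psi α) (X i)) i
  have hM0 : 0 ≤ M := ENNReal.toReal_nonneg
  have hlt : ∀ i r, M < r → orliczNorm μ (psi α) (X i) < ENNReal.ofReal r := fun i r hr =>
    (hle i).trans_lt ((ENNReal.ofReal_lt_ofReal_iff_of_nonneg hM0).2 hr)
  have hint : ∀ i, Integrable (fun ω => X i ω ^ 2) μ := fun i =>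
    (integrable_sq_of_orliczNorm_lt hα (hX i) (by linarith) (hlt i (M + 1) (by linarith))).1
  have hVi : ∀ i, 0 ≤ ∫ ω, X i ω ^ 2 ∂μ := fun i => integral_nonneg fun ω => sq_nonneg _
  set V := ∑ i, ∫ ω, X i ω ^ 2 ∂μ with hV
  rcases (Finset.sum_nonneg fun i _ => hVi i : 0 ≤ V).eq_or_lt with hV0 | hVpos
  -- Here `(√0)⁻¹ = 0` makes `L = 0`, as the convention requires.
  · have hzero : (fun ω => ∑ i, X i ω) =ᵐ[μ] 0 := by
      have h : ∀ i, ∀ᵐ ω ∂μ, X i ω ^ 2 = 0 := fun i =>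
        (integral_eq_zero_iff_of_nonneg (fun ω => sq_nonneg _) (hint i)).1
          ((Finset.sum_eq_zero_iff_of_nonneg fun i _ => hVi i).1 hV0.symm i (Finset.mem_univ i))
      filter_upwards [ae_all_iff.2 h] with ω hω
      exact Finset.sum_eq_zero fun i _ => pow_eq_zero_iff two_ne_zero |>.1 (hω i)
    rw [orliczNorm_Psi_eq_zero_of_ae_eq_zero hLnn hzero]
    exact zero_le
  have hn : 1 ≤ n := by
    rcases Nat.eq_zero_or_pos n with rfl | h
    · simp at hVpos
    · exact h
  have hMpos : 0 < M := by
    refine hM0.lt_of_ne fun h0 => hVpos.ne' (Finset.sum_eq_zero fun i _ => ?_)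
    refine le_antisymm (le_of_forall_pos_le_add fun ε hε => ?_) (hVi i)
    have := (integrable_sq_of_orliczNorm_lt (r := √(ε / 4)) hα (hX i) (by positivity)
      (hlt i _ (h0 ▸ by positivity))).2
    rw [sq_sqrt (by positivity)] at this
    linarith
  have hσ : 0 < √V := sqrt_pos.2 hVpos
  have hn' : (1 : ℝ) ≤ n := by exact_mod_cast hn
  have hlog : 1 / 2 ≤ log ((n : ℝ) + 1) :=
    (by linarith [log_two_gt_d9] : 1 / 2 ≤ log 2).trans
      (log_le_log two_pos (by linarith))
  set ℓ := log ((n : ℝ) + 1) with hℓ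
  have hℓ0 : 0 < ℓ := by linarith
  have hκ : 0 < (6 * ℓ) ^ (1 / α) := by positivity
  have hκb : ((6 * ℓ) ^ (1 / α)) ^ α = 6 * ℓ := by
    rw [one_div, rpow_inv_rpow (by positivity) hα0.ne']
  -- The moment bounds need a radius strictly above the norms, hence `2 * M`.
  have hmgf := fun l hl => mgf_sum_le_of_orliczNorm_lt (b := 6 * ℓ) (r := 2 * M) (l := l) hα hX hind
    (by positivity) (fun i => hlt i _ (by linarith)) hmean (by linarith) hκ hκb hl
  have he : 2 ≤ exp 1 := by linarith [add_one_le_exp 1]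
  have h6 : 2 ≤ √6 := le_sqrt_of_sq_le (by norm_num)
  have h4 : 1 ≤ (4 : ℝ) ^ (1 / α) := one_le_rpow (by norm_num) (by positivity)
  refine orliczNorm_Psi_le_of_tail (by fun_prop) hLnn (by positivity) fun t ht => ?_
  have htail := measureReal_abs_ge_le_of_mgf_le (μ := μ) (S := fun ω => ∑ i, X i ω) (σ := √V)
    (K := (6 * ℓ) ^ (1 / α) * (2 * M)) (d := 2 / 5)
    (c₁ := 2 * exp 1 * √6) (c₂ := 4 * exp 1 * 4 ^ (1 / α)) hσ (by positivity)
    (by nlinarith) (by nlinarith) (fun l hl => (hmgf l hl).1)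
    (fun l hl => (hmgf l hl).2.trans (exp_le_exp.2 (by
      rw [sq_sqrt hVpos.le]
      linarith [nat_mul_exp_one_sub_le hn]))) ht
  -- This identity fixes `C = 8 * 6 ^ (1 / α)`.
  have hset : 2 * exp 1 * √6 * √V * (√t + L * t) = 2 * exp 1 * √6 * √V * √t +
      4 * exp 1 * 4 ^ (1 / α) * ((6 * ℓ) ^ (1 / α) * (2 * M)) * t := by
    rw [hL, mul_rpow (by norm_num) hℓ0.le]
    field_simp
    ring
  rw [hset]
  refine htail.trans ?_
  -- The two-sided prefactor `2 * exp (2 / 5)` must not exceed `3`.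
  have hexp : exp (2 / 5) ≤ 3 / 2 := by
    have h5 : exp (2 / 5) ^ 5 = exp 1 ^ 2 := by
      rw [← exp_nat_mul, ← exp_nat_mul]
      norm_num
    refine le_of_pow_le_pow_left₀ (n := 5) (by norm_num) (by norm_num) ?_
    rw [h5]
    nlinarith [exp_one_lt_d9]
  rw [sub_eq_add_neg, exp_add, neg_mul]
  nlinarith [exp_pos (-(4 * t))]
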